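/- Let $A$ be a unital C*-algebra and $\mathbb J$ a finite or countable index set. A (left) Hilbert $A$-module carries an $A$-valued inner product $\langle\cdot,\cdot\rangle$ that is $A$-linear in the first argument, and is complete in the norm $\|x\|=\|\langle x,x\rangle\|^{1/2}$. A sequence $\{x_j\}_{j\in\mathbb J}$ in a Hilbert $A$-module $\mathcal H$ is a \emph{standard frame} if there are real constants $C,D>0$ such that for every $x\in\mathcal H$ the sum $\sum_j\langle x,x_j\rangle\langle x_j,x\rangle$ converges in norm and $$C\,\langle x,x\rangle\le\sum_j\langle x,x_j\rangle\langle x_j,x\rangle\le D\,\langle x,x\rangle ;$$ it is a \emph{standard normalized tight frame} if this holds with $C=D=1$. A sequence $\{x_j\}_j$ is an \emph{orthogonal Hilbert basis} of $\mathcal H$ if its elements are pairwise orthogonal, their $A$-linear span is norm-dense in $\mathcal H$, and $\sum_j a_jx_j=0$ with $a_j\in A$ implies $a_jx_j=0$ for all $j$. Standard frames $\{x_j\}_j$ of $\mathcal H$ and $\{y_j\}_j$ of $\mathcal K$ are \emph{strongly complementary to each other} if there are invertible adjointable bounded $A$-linear operators $T_1$ on $\mathcal H$ and $T_2$ on $\mathcal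 K$ such that $\{T_1x_j\}_j$ and $\{T_2y_j\}_j$ are standard normalized tight frames and $\{T_1x_j\oplus T_2y_j\}_j$ is a normalized tight frame and an orthogonal Hilbert basis of $\mathcal H\oplus\mathcal K$. Proposition. Let $\{x_j\}_j$ be a standard frame of a finitely or countably generated Hilbert $A$-module $\mathcal H$. Let $\{y_j\}_j$ and $\{z_j\}_j$ be standard frames of Hilbert $A$-modules $\mathcal K$ and $\mathcal L$, respectively, that are both strongly complementary to $\{x_j\}_j$. Suppose $\langle y_j,y_j\rangle=\langle z_j,z_j\rangle$ for every $j\in\mathbb J$. Then there exists an invertible adjointable bounded $A$-linear operator $T:\mathcal K\to\mathcal L$ such that $z_j=T(y_j)$ for every $j\in\mathbb J$, i.e. the frames $\{y_j\}_j$ and $\{z_j\}_j$ are similar. -/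

import Mathlib

open scoped WithCStarModule

namespace HilbertModuleFrame

section Definitions

variable (A : Type*) [CStarAlgebra A] [PartialOrder A] [StarOrderedRing A]

/-- The `A`-valued inner product `⟨x, y⟩` of a left Hilbert `A`-module, in the convention in which it
is `A`-linear in the first argument and conjugate-linear in the second one. Mathlib's `inner A` has
`inner A x (a • y) = a * inner A x y`, so the arguments are exchanged. -/
def ip {E : Type*} [Inner A E] (x y : E) : A := inner A y x

section OneModule

variable {J H : Type*} [NormedAddCommGroup H] [NormedSpace ℂ H] [Module A H] [CStarModule A H]

/-- `H` is finitely or countably generated: the `A`-linear span of some countable subset is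
norm-dense in `H`. -/
def CountablyGenerated (H : Type*) [NormedAddCommGroup H] [Module A H] : Prop :=
  ∃ S : Set H, S.Countable ∧ Dense (Submodule.span A S : Set H)

/-- `x` is a standard frame of `H` with (not necessarily optimal) frame bounds `C` and `D`: for every
`h`, the sum `∑ j, ⟨h, x j⟩ ⟨x j, h⟩` converges in norm and lies between `C ⟨h, h⟩` and
`D ⟨h, h⟩`. -/
def StandardFrameWithBounds (x : J → H) (C D : ℝ) : Prop :=
  ∀ h : H, Summable (fun j => ip A h (x j) * ip A (x j) h) ∧
    C • ip A h h ≤ ∑' j, ip A h (x j) * ip A (x j) h ∧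
    ∑' j, ip A h (x j) * ip A (x j) h ≤ D • ip A h h

/-- `x` is a standard frame of `H`. -/
def IsStandardFrame (x : J → H) : Prop :=
  ∃ C D : ℝ, 0 < C ∧ 0 < D ∧ StandardFrameWithBounds A x C D

/-- `x` is a standard normalized tight frame of `H`. -/
def IsStandardNormalizedTightFrame (x : J → H) : Prop :=
  StandardFrameWithBounds A x 1 1

/-- `x` is a Hilbert basis of `H`: its `A`-linear span is norm-dense, and an `A`-linear combination
`∑ j, a j • x j` vanishes only if each summand vanishes. -/
def IsHilbertBasis (x : J → H) : Prop :=
  Dense (Submodule.span A (Set.range x) : Set H) ∧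
    ∀ a : J → A, HasSum (fun j => a j • x j) 0 → ∀ j, a j • x j = 0

/-- `x` is a Hilbert basis of `H` with pairwise orthogonal elements. -/
def IsOrthogonalHilbertBasis (x : J → H) : Prop :=
  IsHilbertBasis A x ∧ ∀ i j, i ≠ j → ip A (x i) (x j) = 0

end OneModule

section TwoModules

variable {J H K : Type*}
  [NormedAddCommGroup H] [NormedSpace ℂ H] [Module A H] [CStarModule A H]
  [NormedAddCommGroup K] [NormedSpace ℂ K] [Module A K] [CStarModule A K]

/-- `T` has an adjoint with respect to the `A`-valued inner products. -/
def IsAdjointable (T : H → K) : Prop :=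
  ∃ T' : K → H, ∀ x y, ip A (T x) y = ip A x (T' y)

/-- The sequences `x` and `y` are similar: some invertible adjointable bounded `A`-linear operator
maps `x j` to `y j` for every `j`. -/
def AreSimilar (x : J → H) (y : J → K) : Prop :=
  ∃ T : H ≃L[A] K, IsAdjointable A T ∧ ∀ j, T (x j) = y j

/-- The inner sum `{x j ⊕ y j}` in the Hilbert `A`-module `H ⊕ K`, whose inner product is
`⟨h ⊕ k, h' ⊕ k'⟩ = ⟨h, h'⟩ + ⟨k, k'⟩`. -/
def innerSum (x : J → H) (y : J → K) : J → C⋆ᵐᵒᵈ(A, H × K) :=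
  fun j => (WithCStarModule.equiv A (H × K)).symm (x j, y j)

/-- `x` and `y` are strongly complementary normalized tight frames: both are standard normalized
tight frames, and their inner sum is a normalized tight frame and an orthogonal Hilbert basis of
`H ⊕ K`. -/
def StronglyComplementaryTight (x : J → H) (y : J → K) : Prop :=
  IsStandardNormalizedTightFrame A x ∧ IsStandardNormalizedTightFrame A y ∧
    IsStandardNormalizedTightFrame A (innerSum A x y) ∧
    IsOrthogonalHilbertBasis A (innerSum A x y)

/-- The standard frames `x` of `H` and `y` of `K` are strongly complementary to each other: the pair
`(x, y)` is similar, by an operator `T₁ ⊕ T₂` of `H ⊕ K`, to a pair of strongly complementary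
normalized tight frames of `H` and `K`. -/
def StronglyComplementary (x : J → H) (y : J → K) : Prop :=
  IsStandardFrame A x ∧ IsStandardFrame A y ∧
    ∃ (x' : J → H) (y' : J → K),
      AreSimilar A x x' ∧ AreSimilar A y y' ∧ StronglyComplementaryTight A x' y'

end TwoModules

end Definitions

end HilbertModuleFrame

namespace HilbertModuleFrame

/-! Let `x' ⊕ y'` and `x'' ⊕ z'` be the two orthogonal tight sums. They have the same Gram matrix:
off the diagonal both vanish, and on it sit projections `p` and `q`. Now `p` fixes `x' j` and `y'
j`; being fixed passes along `A`-linear bijections and, by `hyz`, from `y j` to `z j`, so `p * q =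
q`. By symmetry `q * p = p`, and taking adjoints gives `p = q`. The Gram matrices of `x'` and `x''`
also agree (`ip_map_eq_of_tight`), so subtraction leaves equal Gram matrices for `y'` and `z'`.
Normalized tight frames with equal Gram matrices are unitarily equivalent (`areSimilar_of_gram`),
and composing with the given similarities joins `y` to `z`. -/

lemma eq_of_mul_eq_of_star_eq {A : Type*} [Mul A] [StarMul A] {p q : A}
    (hp : star p = p) (hq : star q = q) (hpq : p * q = q) (hqp : q * p = p) : p = q := by
  rw [← hqp, ← hq, ← hp, ← star_mul, hpq]

/-! ### Calculus of the `A`-valued inner product. -/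

section OneModule

variable {A : Type*} [CStarAlgebra A] [PartialOrder A]
  {H : Type*} [NormedAddCommGroup H] [NormedSpace ℂ H] [Module A H] [CStarModule A H]
  {J : Type*}

lemma star_ip (x y : H) : star (ip A x y) = ip A y x := CStarModule.star_inner _ _

lemma ip_add_left (x y z : H) : ip A (x + y) z = ip A x z + ip A y z := by simp [ip]

lemma ip_sub_left (x y z : H) : ip A (x - y) z = ip A x z - ip A y z := by simp [ip]

lemma ip_sub_right (x y z : H) : ip A x (y - z) = ip A x y - ip A x z := by simp [ip]

lemma ip_smul_left (a : A) (x y : H) : ip A (a • x) y = a * ip A x y := by simp [ip]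

lemma ip_smul_right (a : A) (x y : H) : ip A x (a • y) = ip A x y * star a := by simp [ip]

lemma ip_real_smul_left (r : ℝ) (x y : H) : ip A (r • x) y = r • ip A x y :=
  CStarModule.inner_smul_right_real

lemma ip_real_smul_right (r : ℝ) (x y : H) : ip A x (r • y) = r • ip A x y :=
  CStarModule.inner_smul_left_real

lemma ip_sum_left {ι : Type*} (s : Finset ι) (f : ι → H) (y : H) :
    ip A (∑ i ∈ s, f i) y = ∑ i ∈ s, ip A (f i) y := by simp [ip]

lemma ip_sum_right {ι : Type*} (s : Finset ι) (x : H) (f : ι → H) :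
    ip A x (∑ i ∈ s, f i) = ∑ i ∈ s, ip A x (f i) := by simp [ip]

lemma ip_self_nonneg (x : H) : 0 ≤ ip A x x := CStarModule.inner_self_nonneg

lemma ip_self_eq_zero {x : H} : ip A x x = 0 ↔ x = 0 := CStarModule.inner_self

lemma norm_sq_eq_norm_ip (x : H) : ‖x‖ ^ 2 = ‖ip A x x‖ := CStarModule.norm_sq_eq A

variable (A) in
lemma ext_ip_left {x y : H} (h : ∀ k : H, ip A x k = ip A y k) : x = y := by
  rw [← sub_eq_zero, ← ip_self_eq_zero (A := A), ip_sub_left, h, sub_self]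

lemma IsStandardNormalizedTightFrame.tsum_eq {x : J → H}
    (hx : IsStandardNormalizedTightFrame A x) (h : H) :
    ∑' j, ip A h (x j) * ip A (x j) h = ip A h h :=
  le_antisymm (by simpa using (hx h).2.2) (by simpa using (hx h).2.1)

section Order

variable [StarOrderedRing A]

lemma hasSum_ip_left {f : J → H} {x : H} (hf : HasSum f x) (y : H) :
    HasSum (fun j => ip A (f j) y) (ip A x y) :=
  hf.mapL (CStarModule.innerSL (A := A) y)

lemma hasSum_ip_right {f : J → H} {x : H} (hf : HasSum f x) (y : H) :
    HasSum (fun j => ip A y (f j)) (ip A y x) := by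
  simpa only [star_ip] using (hasSum_ip_left (A := A) hf y).star

/-- A symmetric operator `F` with `0 ≤ F ≤ D` satisfies `F ^ 2 ≤ D F`. -/
lemma ip_map_map_le (F : H →ₗ[ℝ] H) (hsymm : ∀ h k, ip A (F h) k = ip A h (F k)) {D : ℝ}
    (hD : 0 < D) (hpos : ∀ h, 0 ≤ ip A (F h) h) (hle : ∀ h, ip A (F h) h ≤ D • ip A h h) (h : H) :
    ip A (F h) (F h) ≤ D • ip A (F h) h := by
  -- This is `D(DF - F²) = F(D - F)F + (D - F)F(D - F)`, a sum of two positive terms.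
  have key : D • (D • ip A (F h) h - ip A (F h) (F h)) =
      (D • ip A (F h) (F h) - ip A (F (F h)) (F h)) + ip A (F (D • h - F h)) (D • h - F h) := by
    simp only [map_sub, map_smul, ip_sub_left, ip_sub_right, ip_real_smul_left,
      ip_real_smul_right, smul_sub, hsymm (F h) h]
    abel
  have hnonneg : 0 ≤ D • (D • ip A (F h) h - ip A (F h) (F h)) := by
    rw [key]
    exact add_nonneg (sub_nonneg.2 (hle _)) (hpos _)
  have := smul_nonneg (inv_nonneg.2 hD.le) hnonneg
  rwa [inv_smul_smul₀ hD.ne', sub_nonneg] at this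

lemma ip_mul_ip_nonneg (h k : H) : 0 ≤ ip A h k * ip A k h := by
  rw [← star_ip h k]
  exact mul_star_self_nonneg _

end Order

/-! ### Frame operators and reconstruction. -/

section Frame

variable [IsScalarTower ℂ A H]

variable (A) in
/-- The partial sum `h ↦ ∑ j ∈ s, ⟨h, x j⟩ x j` of the frame operator of `x`. -/
noncomputable def partialFrameOp (x : J → H) (s : Finset J) : H →ₗ[ℝ] H where
  toFun h := ∑ j ∈ s, ip A h (x j) • x j
  map_add' h k := by simp only [ip_add_left, add_smul, Finset.sum_add_distrib]
  map_smul' r h := by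
    simp only [ip_real_smul_left, Finset.smul_sum, RingHom.id_apply]
    exact Finset.sum_congr rfl fun j _ => by
      rw [← Complex.coe_smul, smul_assoc, Complex.coe_smul]

lemma partialFrameOp_apply (x : J → H) (s : Finset J) (h : H) :
    partialFrameOp A x s h = ∑ j ∈ s, ip A h (x j) • x j := rfl

lemma ip_partialFrameOp_left (x : J → H) (s : Finset J) (h k : H) :
    ip A (partialFrameOp A x s h) k = ∑ j ∈ s, ip A h (x j) * ip A (x j) k := by
  simp only [partialFrameOp_apply, ip_sum_left, ip_smul_left]

lemma ip_partialFrameOp_symm (x : J → H) (s : Finset J) (h k : H) :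
    ip A (partialFrameOp A x s h) k = ip A h (partialFrameOp A x s k) := by
  rw [ip_partialFrameOp_left]
  simp only [partialFrameOp_apply, ip_sum_right, ip_smul_right, star_ip]

variable [StarOrderedRing A]

lemma ip_partialFrameOp_nonneg (x : J → H) (s : Finset J) (h : H) :
    0 ≤ ip A (partialFrameOp A x s h) h := by
  rw [ip_partialFrameOp_left]
  exact Finset.sum_nonneg fun j _ => ip_mul_ip_nonneg h (x j)

lemma StandardFrameWithBounds.ip_partialFrameOp_le {x : J → H} {C D : ℝ}
    (hx : StandardFrameWithBounds A x C D) (s : Finset J) (h : H) :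
    ip A (partialFrameOp A x s h) h ≤ D • ip A h h := by
  rw [ip_partialFrameOp_left]
  exact ((hx h).1.sum_le_tsum s fun j _ => ip_mul_ip_nonneg h (x j)).trans (hx h).2.2

/-- The frame operator of a standard frame converges strongly. -/
lemma IsStandardFrame.summable [CompleteSpace H] {x : J → H} (hx : IsStandardFrame A x) (h : H) :
    Summable fun j => ip A h (x j) • x j := by
  obtain ⟨C, D, -, hD, hx⟩ := hx
  rw [summable_iff_vanishing_norm]
  intro ε hε
  obtain ⟨s, hs⟩ := summable_iff_vanishing_norm.1 (hx h).1 (ε ^ 2 / D) (by positivity)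
  refine ⟨s, fun t ht => ?_⟩
  have hbound : ‖partialFrameOp A x t h‖ ^ 2 < ε ^ 2 := by
    calc ‖partialFrameOp A x t h‖ ^ 2
        = ‖ip A (partialFrameOp A x t h) (partialFrameOp A x t h)‖ := norm_sq_eq_norm_ip _
      _ ≤ ‖D • ip A (partialFrameOp A x t h) h‖ :=
          CStarAlgebra.norm_le_norm_of_nonneg_of_le (ip_self_nonneg _)
            (ip_map_map_le _ (ip_partialFrameOp_symm x t) hD (ip_partialFrameOp_nonneg x t)
              (hx.ip_partialFrameOp_le t) h)
      _ = D * ‖∑ j ∈ t, ip A h (x j) * ip A (x j) h‖ := by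
          rw [norm_smul, Real.norm_of_nonneg hD.le, ip_partialFrameOp_left]
      _ < D * (ε ^ 2 / D) := by gcongr; exact hs t ht
      _ = ε ^ 2 := by field_simp
  exact lt_of_pow_lt_pow_left₀ 2 hε.le hbound

/-- The reconstruction formula of a standard normalized tight frame. -/
lemma IsStandardNormalizedTightFrame.hasSum {x : J → H}
    (hx : IsStandardNormalizedTightFrame A x) (h : H) :
    HasSum (fun j => ip A h (x j) • x j) h := by
  have hle (s : Finset J) : ‖h - partialFrameOp A x s h‖ ^ 2 ≤
      ‖ip A h h - ∑ j ∈ s, ip A h (x j) * ip A (x j) h‖ := by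
    -- The remainder `1 - F` of a partial frame operator satisfies `0 ≤ 1 - F ≤ 1`, hence `(1 - F)²
    -- ≤ 1 - F`.
    have := ip_map_map_le (A := A) (LinearMap.id - partialFrameOp A x s)
      (fun h k => by simp [ip_sub_left, ip_sub_right, ip_partialFrameOp_symm]) one_pos
      (fun h => by
        simpa [ip_sub_left] using StandardFrameWithBounds.ip_partialFrameOp_le hx s h)
      (fun h => by simpa [ip_sub_left] using ip_partialFrameOp_nonneg x s h) h
    rw [norm_sq_eq_norm_ip (A := A), ← ip_partialFrameOp_left, ← ip_sub_left]
    refine CStarAlgebra.norm_le_norm_of_nonneg_of_le (ip_self_nonneg _) ?_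
    simpa using this
  have hlim := (hx h).1.hasSum
  rw [hx.tsum_eq] at hlim
  have h0 : Filter.Tendsto (fun s : Finset J =>
      √‖ip A h h - ∑ j ∈ s, ip A h (x j) * ip A (x j) h‖) Filter.atTop (nhds 0) := by
    have := ((tendsto_const_nhds (x := ip A h h)).sub hlim).norm.sqrt
    simpa using this
  rw [HasSum, tendsto_iff_norm_sub_tendsto_zero]
  refine squeeze_zero (fun _ => norm_nonneg _) (fun s => ?_) h0
  rw [norm_sub_rev]
  exact Real.le_sqrt_of_sq_le (hle s)

/-- Two normalized tight frames that are images of the same sequence under invertible adjointable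
operators have the same Gram matrix. -/
lemma ip_map_eq_of_tight {x : J → H} {S T : H ≃L[A] H} (hS : IsAdjointable A S)
    (hT : IsAdjointable A T) (hSx : IsStandardNormalizedTightFrame A (fun j => S (x j)))
    (hTx : IsStandardNormalizedTightFrame A (fun j => T (x j))) (a b : H) :
    ip A (S a) (S b) = ip A (T a) (T b) := by
  -- Pulling reconstruction back through `R` shows that `R' R` is a right inverse of the frame
  -- operator of `x`. This holds for `S` and `T` alike, so expanding `a` by `T` and `b` by `S` gives
  -- the same double expression.
  have expand {R : H ≃L[A] H} {R' : H → H} (hR : ∀ x y, ip A (R x) y = ip A x (R' y))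
      (hRx : IsStandardNormalizedTightFrame A (fun j => R (x j))) (h : H) :
      HasSum (fun j => ip A (R' (R h)) (x j) • x j) h := by
    have h1 := (hRx.hasSum (R h)).map R.symm R.symm.continuous
    convert h1 using 1
    · funext j
      simp only [Function.comp_apply, map_smul, ContinuousLinearEquiv.symm_apply_apply]
      rw [← star_ip, ← hR, star_ip]
    · simp
  obtain ⟨S', hS⟩ := hS
  obtain ⟨T', hT⟩ := hT
  have h1 := hasSum_ip_left (A := A) (expand hT hTx a) (S' (S b))
  have h2 := hasSum_ip_right (A := A) (expand hS hSx b) (T' (T a))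
  simp only [ip_smul_left, ip_smul_right, star_ip] at h1 h2
  rw [hS, h1.unique h2, ← star_ip, ← hT, star_ip]

/-- The inverse of an operator that maps some standard frame to a normalized tight
frame is adjointable. -/
lemma isAdjointable_symm_of_tight [CompleteSpace H] {x : J → H} (hx : IsStandardFrame A x)
    {T : H ≃L[A] H}
    (hTx : IsStandardNormalizedTightFrame A (fun j => T (x j))) : IsAdjointable A T.symm := by
  -- The frame operator of `x` is `T⁻¹ (T⁻¹)*`, so `(T⁻¹)*` must be `T` after the frame operator.
  refine ⟨fun k => T (∑' j, ip A k (x j) • x j), fun h k => ?_⟩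
  have h1 := (hTx.hasSum h).map T.symm T.symm.continuous
  simp only [Function.comp_def, map_smul, ContinuousLinearEquiv.symm_apply_apply] at h1
  have h2 := (hx.summable k).hasSum.map T T.continuous
  have h3 := hasSum_ip_left (A := A) h1 k
  have h4 := hasSum_ip_right (A := A) h2 h
  simp only [Function.comp_def, map_smul, ip_smul_left, ip_smul_right, star_ip] at h3 h4
  exact h3.unique h4

end Frame

end OneModule

/-! ### Comparison of two frames through their Gram matrices. -/

section TwoModules

variable {A : Type*} [CStarAlgebra A] [PartialOrder A]
  {J H K L : Type*}
  [NormedAddCommGroup H] [NormedSpace ℂ H] [Module A H] [CStarModule A H]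
  [NormedAddCommGroup K] [NormedSpace ℂ K] [Module A K] [CStarModule A K]
  [NormedAddCommGroup L] [NormedSpace ℂ L] [Module A L] [CStarModule A L]

lemma IsAdjointable.comp {T : H → K} {S : K → L} (hS : IsAdjointable A S)
    (hT : IsAdjointable A T) : IsAdjointable A (S ∘ T) := by
  obtain ⟨S', hS⟩ := hS
  obtain ⟨T', hT⟩ := hT
  exact ⟨T' ∘ S', fun x y => by simp only [Function.comp_apply, hS, hT]⟩

/-- Expanding `⟨h - a • h, h - a • h⟩` leaves only multiples of `⟨h, h⟩ - a * ⟨h, h⟩`. Thus the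
inner square alone decides whether `a` fixes `h`. -/
lemma mul_ip_self_eq_iff {a : A} {h : H} : a * ip A h h = ip A h h ↔ a • h = h := by
  refine ⟨fun ha => ?_, fun ha => by rw [← ip_smul_left, ha]⟩
  rw [eq_comm, ← sub_eq_zero, ← ip_self_eq_zero (A := A)]
  simp only [ip_sub_left, ip_sub_right, ip_smul_left, ip_smul_right, ha, sub_self, zero_mul]

lemma AreSimilar.smul_eq_iff {x : J → H} {y : J → K} (hxy : AreSimilar A x y) {a : A} {j : J} :
    a • y j = y j ↔ a • x j = x j := by
  obtain ⟨T, -, hT⟩ := hxy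
  rw [← hT, ← map_smul, T.injective.eq_iff]

/-- The elements of an orthogonal normalized tight frame have idempotent inner squares. -/
lemma IsStandardNormalizedTightFrame.ip_mul_ip_self {x : J → H}
    (hx : IsStandardNormalizedTightFrame A x) (hort : ∀ i j, i ≠ j → ip A (x i) (x j) = 0)
    (j : J) : ip A (x j) (x j) * ip A (x j) (x j) = ip A (x j) (x j) := by
  refine Eq.trans (Eq.symm ?_) (hx.tsum_eq (x j))
  exact (tsum_eq_single j fun i hi => by rw [hort i j hi, mul_zero])

lemma norm_sum_smul_eq_of_gram {y : J → K} {z : J → L}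
    (hyz : ∀ i j, ip A (y i) (y j) = ip A (z i) (z j)) (s : Finset J) (a : J → A) :
    ‖∑ j ∈ s, a j • y j‖ = ‖∑ j ∈ s, a j • z j‖ := by
  rw [← sq_eq_sq₀ (norm_nonneg _) (norm_nonneg _), norm_sq_eq_norm_ip (A := A),
    norm_sq_eq_norm_ip (A := A)]
  simp only [ip_sum_left, ip_sum_right, ip_smul_left, ip_smul_right, hyz]

/-- Finite partial sums over `y` and `z` have equal norms, so the Cauchy criterion transfers. -/
lemma summable_smul_of_gram [CompleteSpace K] [CompleteSpace L] {y : J → K} {z : J → L}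
    (hyz : ∀ i j, ip A (y i) (y j) = ip A (z i) (z j)) {a : J → A}
    (hy : Summable fun j => a j • y j) : Summable fun j => a j • z j := by
  simpa only [summable_iff_vanishing_norm, norm_sum_smul_eq_of_gram hyz] using hy

variable [StarOrderedRing A]

lemma ip_innerSum (x : J → H) (y : J → K) (i j : J) :
    ip A (innerSum A x y i) (innerSum A x y j) = ip A (x i) (x j) + ip A (y i) (y j) := rfl

variable (A) in
/-- The operator `k ↦ ∑ j, ⟨k, y j⟩ z j`. -/
noncomputable def mixedFrameOp (y : J → K) (z : J → L) (k : K) : L := ∑' j, ip A k (y j) • z j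

section Gram

variable {y : J → K} {z : J → L}

lemma mixedFrameOp_apply_frame [IsScalarTower ℂ A L]
    (hz : IsStandardNormalizedTightFrame A z)
    (hyz : ∀ i j, ip A (y i) (y j) = ip A (z i) (z j)) (i : J) :
    mixedFrameOp A y z (y i) = z i := by
  simp only [mixedFrameOp, hyz]
  exact (hz.hasSum (z i)).tsum_eq

variable [IsScalarTower ℂ A K] [CompleteSpace K] [CompleteSpace L]

lemma hasSum_mixedFrameOp (hy : IsStandardNormalizedTightFrame A y)
    (hyz : ∀ i j, ip A (y i) (y j) = ip A (z i) (z j)) (k : K) :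
    HasSum (fun j => ip A k (y j) • z j) (mixedFrameOp A y z k) :=
  (summable_smul_of_gram hyz (hy.hasSum k).summable).hasSum

lemma ip_mixedFrameOp_apply (hy : IsStandardNormalizedTightFrame A y)
    (hyz : ∀ i j, ip A (y i) (y j) = ip A (z i) (z j)) (k : K) (i : J) :
    ip A (mixedFrameOp A y z k) (z i) = ip A k (y i) := by
  have h1 := hasSum_ip_left (A := A) (hasSum_mixedFrameOp hy hyz k) (z i)
  have h2 := hasSum_ip_left (A := A) (hy.hasSum k) (y i)
  simp only [ip_smul_left, ← hyz] at h1 h2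
  exact h1.unique h2

/-- The first operator preserves frame coefficients, so the second one is reconstruction in `K`. -/
lemma mixedFrameOp_mixedFrameOp (hy : IsStandardNormalizedTightFrame A y)
    (hyz : ∀ i j, ip A (y i) (y j) = ip A (z i) (z j)) (k : K) :
    mixedFrameOp A z y (mixedFrameOp A y z k) = k := by
  rw [mixedFrameOp]
  simp only [ip_mixedFrameOp_apply hy hyz]
  exact (hy.hasSum k).tsum_eq

variable [IsScalarTower ℂ A L]

lemma ip_mixedFrameOp_left (hy : IsStandardNormalizedTightFrame A y)
    (hz : IsStandardNormalizedTightFrame A z)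
    (hyz : ∀ i j, ip A (y i) (y j) = ip A (z i) (z j)) (k : K) (l : L) :
    ip A (mixedFrameOp A y z k) l = ip A k (mixedFrameOp A z y l) := by
  have h1 := hasSum_ip_left (A := A) (hasSum_mixedFrameOp hy hyz k) l
  have h2 := hasSum_ip_right (A := A) (hasSum_mixedFrameOp hz (fun i j => (hyz i j).symm) l) k
  simp only [ip_smul_left, ip_smul_right, star_ip] at h1 h2
  exact h1.unique h2

/-- Normalized tight frames with the same Gram matrix are unitarily equivalent. -/
lemma areSimilar_of_gram (hy : IsStandardNormalizedTightFrame A y)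
    (hz : IsStandardNormalizedTightFrame A z)
    (hyz : ∀ i j, ip A (y i) (y j) = ip A (z i) (z j)) : AreSimilar A y z := by
  have hzy i j := (hyz i j).symm
  let U : K ≃ₗᵢ[A] L :=
    { toFun := mixedFrameOp A y z
      invFun := mixedFrameOp A z y
      -- Linearity follows from having an adjoint, without manipulating the series.
      map_add' := fun k k' => ext_ip_left A fun l => by
        simp only [ip_mixedFrameOp_left hy hz hyz, ip_add_left]
      map_smul' := fun a k => ext_ip_left A fun l => by
        simp only [ip_mixedFrameOp_left hy hz hyz, ip_smul_left, RingHom.id_apply]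
      left_inv := mixedFrameOp_mixedFrameOp hy hyz
      right_inv := mixedFrameOp_mixedFrameOp hz hzy
      norm_map' := fun k => by
        change ‖mixedFrameOp A y z k‖ = ‖k‖
        rw [← sq_eq_sq₀ (norm_nonneg _) (norm_nonneg _), norm_sq_eq_norm_ip (A := A),
          norm_sq_eq_norm_ip (A := A), ip_mixedFrameOp_left hy hz hyz,
          mixedFrameOp_mixedFrameOp hy hyz] }
  exact ⟨U.toContinuousLinearEquiv, ⟨mixedFrameOp A z y, ip_mixedFrameOp_left hy hz hyz⟩,
    mixedFrameOp_apply_frame hz hyz⟩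

end Gram

/-- The idempotent `p` fixes both components of its own vector. Fixedness travels `x' → x → x''` by
similarity and `y' → y → z → z'`, where the middle step uses only inner squares. -/
lemma StronglyComplementaryTight.ip_innerSum_mul_eq {x x' x'' : J → H} {y y' : J → K}
    {z z' : J → L} (hx' : AreSimilar A x x') (hx'' : AreSimilar A x x'')
    (hy : AreSimilar A y y') (hz : AreSimilar A z z')
    (h : StronglyComplementaryTight A x' y') (hyz : ∀ j, ip A (y j) (y j) = ip A (z j) (z j))
    (j : J) : ip A (innerSum A x' y' j) (innerSum A x' y' j) *
      ip A (innerSum A x'' z' j) (innerSum A x'' z' j) =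
        ip A (innerSum A x'' z' j) (innerSum A x'' z' j) := by
  have hp : ip A (innerSum A x' y' j) (innerSum A x' y' j) • innerSum A x' y' j =
      innerSum A x' y' j :=
    mul_ip_self_eq_iff.1 (h.2.2.1.ip_mul_ip_self h.2.2.2.2 j)
  generalize ip A (innerSum A x' y' j) (innerSum A x' y' j) = p at hp
  have hpx : p • x' j = x' j := congrArg (fun w => w.1) hp
  have hpy : p • y' j = y' j := congrArg (fun w => w.2) hp
  rw [hx'.smul_eq_iff, ← hx''.smul_eq_iff] at hpx
  rw [hy.smul_eq_iff, ← mul_ip_self_eq_iff, hyz, mul_ip_self_eq_iff, ← hz.smul_eq_iff] at hpy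
  rw [ip_innerSum, mul_add, mul_ip_self_eq_iff.2 hpx, mul_ip_self_eq_iff.2 hpy]

variable [IsScalarTower ℂ A H] [IsScalarTower ℂ A K] [CompleteSpace K] [IsScalarTower ℂ A L]
  [CompleteSpace L]

/-- Strong complements of the same frame are similar if their elements have the same inner
squares. -/
theorem StronglyComplementary.areSimilar {x : J → H} {y : J → K} {z : J → L}
    (hxy : StronglyComplementary A x y) (hxz : StronglyComplementary A x z)
    (hyz : ∀ j, ip A (y j) (y j) = ip A (z j) (z j)) : AreSimilar A y z := by
  obtain ⟨-, -, x', y', ⟨T, hT, hTx⟩, hyy', h'⟩ := hxy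
  obtain ⟨-, hz, x'', z', ⟨S, hS, hSx⟩, hzz', h''⟩ := hxz
  have hxx' : AreSimilar A x x' := ⟨T, hT, hTx⟩
  have hxx'' : AreSimilar A x x'' := ⟨S, hS, hSx⟩
  have hgramx (i j : J) : ip A (x' i) (x' j) = ip A (x'' i) (x'' j) := by
    rw [← hTx, ← hTx, ← hSx, ← hSx]
    have h1 : IsStandardNormalizedTightFrame A (fun j => T (x j)) := by simpa only [hTx] using h'.1
    have h2 : IsStandardNormalizedTightFrame A (fun j => S (x j)) := by simpa only [hSx] using h''.1
    exact ip_map_eq_of_tight hT hS h1 h2 (x i) (x j)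
  have hgram (i j : J) : ip A (innerSum A x' y' i) (innerSum A x' y' j) =
      ip A (innerSum A x'' z' i) (innerSum A x'' z' j) := by
    by_cases hij : i = j
    · subst hij
      exact eq_of_mul_eq_of_star_eq (star_ip _ _) (star_ip _ _)
        (h'.ip_innerSum_mul_eq hxx' hxx'' hyy' hzz' hyz i)
        (h''.ip_innerSum_mul_eq hxx'' hxx' hzz' hyy' (fun j => (hyz j).symm) i)
    · rw [h'.2.2.2.2 i j hij, h''.2.2.2.2 i j hij]
  -- Cancelling the equal `x`-parts from `hgram` leaves the Gram matrices of `y'` and `z'`.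
  have hyz' : AreSimilar A y' z' := areSimilar_of_gram h'.2.1 h''.2.1 fun i j => by
    simpa only [ip_innerSum, hgramx, add_right_inj] using hgram i j
  obtain ⟨U, hU, hUy⟩ := hyz'
  obtain ⟨V, hV, hVy⟩ := hyy'
  obtain ⟨W, hW, hWz⟩ := hzz'
  have hW' : IsAdjointable A W.symm :=
    isAdjointable_symm_of_tight hz (by simpa only [hWz] using h''.2.1)
  refine ⟨(V.trans U).trans W.symm, hW'.comp (hU.comp hV), fun j => ?_⟩
  simp [hVy, hUy, ← hWz]

end TwoModules

end HilbertModuleFrame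

theorem mainTheorem11
    {A : Type*} [CStarAlgebra A] [PartialOrder A] [StarOrderedRing A]
    {H : Type*} [NormedAddCommGroup H] [NormedSpace ℂ H] [Module A H] [IsScalarTower ℂ A H]
    [SMulCommClass ℂ A H] [CStarModule A H] [CompleteSpace H]
    {K : Type*} [NormedAddCommGroup K] [NormedSpace ℂ K] [Module A K] [IsScalarTower ℂ A K]
    [SMulCommClass ℂ A K] [CStarModule A K] [CompleteSpace K]
    {L : Type*} [NormedAddCommGroup L] [NormedSpace ℂ L] [Module A L] [IsScalarTower ℂ A L]
    [SMulCommClass ℂ A L] [CStarModule A L] [CompleteSpace L]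
    {J : Type*} [Countable J]
    (hH : HilbertModuleFrame.CountablyGenerated A H)
    (x : J → H) (y : J → K) (z : J → L)
    (hx : HilbertModuleFrame.IsStandardFrame A x)
    (hy : HilbertModuleFrame.IsStandardFrame A y)
    (hz : HilbertModuleFrame.IsStandardFrame A z)
    (hxy : HilbertModuleFrame.StronglyComplementary A x y)
    (hxz : HilbertModuleFrame.StronglyComplementary A x z)
    (hyz : ∀ j, HilbertModuleFrame.ip A (y j) (y j) = HilbertModuleFrame.ip A (z j) (z j)) :
    ∃ T : K ≃L[A] L, HilbertModuleFrame.IsAdjointable A T ∧ ∀ j, z j = T (y j) := by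
  obtain ⟨T, hT, hTy⟩ := hxy.areSimilar hxz hyz
  exact ⟨T, hT, fun j => (hTy j).symm⟩
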